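/- Let $n,k\ge 1$. A $k$-arrangement of $[n]=\{1,\dots,n\}$ is a pair $\mathfrak a=(\pi,\phi)$ of a permutation $\pi$ of $[n]$ and an arbitrary function $\phi:\mathrm{FIX}(\pi)\to\{-1,-2,\dots,-k\}$ on the set $\mathrm{FIX}(\pi)=\{i:\pi(i)=i\}$ of fixed points of $\pi$. Let $A_n^k$ be the set of $k$-arrangements of $[n]$. For an array $\mathbf m=(m_1,\dots,m_k)$ of nonnegative integers let $$A_n^k(\mathbf m)=\{(\pi,\phi)\in A_n^k : |\phi^{-1}(-i)|=m_i\ \text{ for } 1\le i\le k\}.$$ The positive reduction of a word over $\mathbb Z$ is obtained by replacing all instances of its $i$-th smallest positive letter by $i$, for all $i$, leaving the other letters unchanged. The derangement form $\mathrm{df}_k(\mathfrak a)$ is the positive reduction of the word obtained from $\pi(1)\pi(2)\cdots\pi(n)$ by changing $\pi(i)$ to $\phi(i)$ for every $i\in\mathrm{FIX}(\pi)$. The permutation form $\mathrm{pf}_k(\mathfrak a)$ is the positive reduction of the word obtained by making this change only for those $i\in\mathrm{FIX}(\pi)$ with $\phi(i)\ne -k$. For a word $w=w_1\cdots w_n$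 over $\mathbb Z$ let $\mathrm{DES}(w)=\{i : 1\le i\le n-1,\ w_i>w_{i+1}\}$. Put $$\mathrm{DES}(\mathfrak a)=\mathrm{DES}(\mathrm{pf}_k(\mathfrak a)),\qquad \mathrm{DEZ}(\mathfrak a)=\mathrm{DES}(\mathrm{df}_k(\mathfrak a)),$$ and let $\mathrm{Der}(\mathfrak a)$ be the subword of $\mathrm{df}_k(\mathfrak a)$ consisting of all its positive letters. Theorem. Let $n,k\ge1$, let $\mathbf m=(m_1,\dots,m_k)$ be an array of nonnegative integers, let $\tau$ be a permutation of $\{1,\dots,k\}$, and put $\mathbf m_\tau=(m_{\tau(1)},\dots,m_{\tau(k)})$. Then there is a bijection $\Phi_k:A_n^k(\mathbf m)\to A_n^k(\mathbf m_\tau)$ such that, for every $\mathfrak a\in A_n^k(\mathbf m)$, $$\mathrm{DEZ}(\mathfrak a)=\mathrm{DES}(\Phi_k(\mathfrak a))\quad\text{and}\quad \mathrm{Der}(\mathfrak a)=\mathrm{Der}(\Phi_k(\mathfrak a)).$$ -/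

import Mathlib

/-- The words considered here are finite sequences of integers `w = w₁ w₂ ⋯`;
the letter `¬i` is the integer `-i`. -/
abbrev IntWord : Type := List ℤ

namespace IntWord

/-- Positive reduction: every instance of the `i`-th smallest positive letter of `w` is
replaced by `i`, and all other letters are kept. The rank `i` of a positive letter `x`
is the number of distinct positive letters of `w` that are at most `x`. -/
def posRed (w : IntWord) : IntWord :=
  w.map fun x => if 0 < x then ((w.toFinset.filter fun y => 0 < y ∧ y ≤ x).card : ℤ) else x

/-- The positive subword, made of all the positive letters in their order of appearance. -/
def pos (w : IntWord) : IntWord :=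
  w.filter fun x => decide (0 < x)

/-- The set of descent positions of `w = w₁ ⋯ wₙ`: the `i` with `1 ≤ i ≤ n - 1` and
`wᵢ > wᵢ₊₁`. Lists are indexed from `0`, so that `wᵢ` is `w[i - 1]` and `wᵢ₊₁` is `w[i]`. -/
def desSet (w : IntWord) : Set ℕ :=
  {i | ∃ (_ : 1 ≤ i) (h : i < w.length), w[i - 1]'(lt_of_le_of_lt (Nat.sub_le i 1) h) > w[i]'h}

end IntWord

/-- A `k`-arrangement of `[n]`: a permutation of `[n]` together with an arbitrary `k`-colouring of
its fixed points. The element `i : Fin n` stands for `i + 1 ∈ [n]`, and the colour `c : Fin k` for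
the letter `¬(c + 1)`. -/
structure KArrangement (n k : ℕ) where
  /-- the base permutation -/
  perm : Equiv.Perm (Fin n)
  /-- the colouring of the fixed points -/
  color : {i : Fin n // perm i = i} → Fin k

namespace KArrangement

variable {n k : ℕ}

/-- The number of fixed points with a given colour. -/
def fixCount (a : KArrangement n k) (c : Fin k) : ℕ :=
  (Finset.univ.filter fun j => a.color j = c).card

/-- The derangement form: each fixed point is replaced by its colour `¬1, …, ¬k`, and the
positive reduction is applied. -/
def derForm (a : KArrangement n k) : IntWord :=
  IntWord.posRed (List.ofFn fun i : Fin n =>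
    if h : a.perm i = i then -(((a.color ⟨i, h⟩ : ℕ) : ℤ) + 1)
    else ((a.perm i : ℕ) : ℤ) + 1)

/-- The permutation form: each fixed point whose colour is not `¬k` is replaced by its colour, and
the positive reduction is applied. -/
def permForm (a : KArrangement n k) : IntWord :=
  IntWord.posRed (List.ofFn fun i : Fin n =>
    if h : a.perm i = i ∧ ∀ h' : a.perm i = i, (a.color ⟨i, h'⟩ : ℕ) + 1 ≠ k then
      -(((a.color ⟨i, h.1⟩ : ℕ) : ℤ) + 1)
    else ((a.perm i : ℕ) : ℤ) + 1)

/-- The descent set of the permutation form. -/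
def DES (a : KArrangement n k) : Set ℕ := a.permForm.desSet

/-- The descent set of the derangement form. -/
def DEZ (a : KArrangement n k) : Set ℕ := a.derForm.desSet

/-- The derangement part: the positive subword of the derangement form. -/
def Der (a : KArrangement n k) : IntWord := a.derForm.pos

/-- The set of `k`-arrangements of `[n]` that have exactly `m c` fixed points of each colour `c`. -/
def withMult (n : ℕ) {k : ℕ} (m : Fin k → ℕ) : Set (KArrangement n k) :=
  {a | ∀ c, a.fixCount c = m c}

end KArrangement

/-!
The bijection exists because the two statistics are equidistributed, jointly with `Der`; by
inclusion–exclusion it suffices to compare, for a fixed derangement part `δ` and a fixed set `D`,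
the arrangements with `DEZ ⊆ D` and those with `DES ⊆ D`
(`KArrangement.card_DEZ_subset_eq_card_DES_subset`, `card_fiber_eq_of_card_subset_eq`).

An arrangement with derangement part `δ` amounts to a word in the colours of its fixed points and
in markers `0, 1, …, d - 1`, in this order, for the letters of `δ` (`CodeWord`,
`KArrangement.card_eq_card_codeWord`). Cut the positions into blocks just before each element of
`D`. Then `DEZ ⊆ D` says that the derangement form is weakly increasing on each block: negative
letters first, then an increasing run of `δ`. Likewise `DES ⊆ D` says that the permutation form is
weakly increasing on each block. The fixed points of the last colour are now positive letters, but
their place is forced: within an increasing run of a permutation, the letters below the diagonal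
come first, then the fixed points, then the letters above the diagonal. Conversely, inserting fixed
points at this place keeps the run increasing, and keeps every other letter on its side of the
diagonal.

So both conditions say that a code word is sorted in each block, for two orders on the letters
(`CodeWord.DEZ_decode_subset_iff`, `CodeWord.DES_decode_subset_iff`). Sorting every block by the
other order is an injection each way (`CodeWord.card_blockSorted_le`): it preserves the content of
each block, and the two orders agree on the markers of a sorted block
(`CodeWord.compatible_derKey_permKey`, `CodeWord.compatible_permKey_derKey`), so the markers stay
in order. In the order for the derangement form all colours play the same role, so they may be
relabelled by `τ` beforehand.
-/

/-! ### Positive reduction and descents -/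

namespace IntWord

/-- The letter that the positive reduction of `w` puts in the place of the letter `x`. -/
def reduce (w : IntWord) (x : ℤ) : ℤ :=
  if 0 < x then ((w.toFinset.filter fun y => 0 < y ∧ y ≤ x).card : ℤ) else x

theorem posRed_eq_map (w : IntWord) : posRed w = w.map (reduce w) := rfl

theorem reduce_pos_iff {w : IntWord} {x : ℤ} (hx : x ∈ w) : 0 < reduce w x ↔ 0 < x := by
  unfold reduce
  split_ifs with h
  · simp only [h, iff_true, Nat.cast_pos, Finset.card_pos]
    exact ⟨x, by simp [hx, h]⟩
  · rfl

theorem reduce_strictMonoOn (w : IntWord) : StrictMonoOn (reduce w) {x | x ∈ w} := by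
  intro x hx y hy hxy
  by_cases h : 0 < x
  · have h' : 0 < y := h.trans hxy
    simp only [reduce, h, h', if_true, Nat.cast_lt]
    apply Finset.card_lt_card
    refine ⟨fun z hz => ?_, fun hsub => ?_⟩
    · simp only [Finset.mem_filter] at hz ⊢
      exact ⟨hz.1, hz.2.1, hz.2.2.trans hxy.le⟩
    · have hmem := @hsub y (by simpa [h'] using hy)
      simp only [Finset.mem_filter] at hmem
      omega
  · by_cases h' : 0 < y
    · have := (reduce_pos_iff hy).2 h'
      have e : reduce w x = x := by simp [reduce, h]
      omega
    · simpa [reduce, h, h'] using hxy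

theorem desSet_posRed (w : IntWord) : (posRed w).desSet = w.desSet := by
  ext i
  simp only [desSet, posRed_eq_map, List.length_map, List.getElem_map, Set.mem_ofPred_eq, gt_iff_lt]
  refine exists_congr fun h1 => exists_congr fun h => ?_
  exact (reduce_strictMonoOn w).lt_iff_lt (List.getElem_mem _) (List.getElem_mem _)

theorem add_one_mem_desSet_ofFn {n : ℕ} (v : Fin n → ℤ) (j : ℕ) :
    j + 1 ∈ desSet (List.ofFn v) ↔
      ∃ h : j + 1 < n, v ⟨j + 1, h⟩ < v ⟨j, Nat.lt_of_succ_lt h⟩ := by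
  simp [desSet]

theorem desSet_ofFn_subset_range {n : ℕ} (v : Fin n → ℤ) :
    desSet (List.ofFn v) ⊆ Finset.range n := by
  rintro i ⟨_, h, _⟩
  simpa using h

theorem desSet_ofFn_subset_iff {n : ℕ} (v : Fin n → ℤ) (D : Set ℕ) :
    desSet (List.ofFn v) ⊆ D ↔
      ∀ j (h : j + 1 < n), v ⟨j + 1, h⟩ < v ⟨j, Nat.lt_of_succ_lt h⟩ → j + 1 ∈ D := by
  constructor
  · intro H j h hlt
    exact H ((add_one_mem_desSet_ofFn v j).2 ⟨h, hlt⟩)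
  · rintro H (_ | j) hj
    · obtain ⟨h, _⟩ := hj
      omega
    · obtain ⟨h, hlt⟩ := (add_one_mem_desSet_ofFn v j).1 hj
      exact H j h hlt

/-- Positions are listed in increasing order on both sides. -/
theorem filter_ofFn {α : Type*} {n d : ℕ} (v : Fin n → α) (p : α → Bool) (e : Fin d ↪o Fin n)
    (he : ∀ i, p (v i) = true ↔ i ∈ Set.range e) :
    (List.ofFn v).filter p = List.ofFn fun r => v (e r) := by
  have key : (List.finRange n).filter (p ∘ v) = (List.finRange d).map e := by
    have h1 : ((List.finRange n).filter (p ∘ v)).Pairwise (· < ·) :=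
      (List.pairwise_lt_finRange n).filter _
    have h2 : ((List.finRange d).map e).Pairwise (· < ·) :=
      List.pairwise_map.2 ((List.pairwise_lt_finRange d).imp fun h => e.strictMono h)
    refine List.Perm.eq_of_pairwise (fun a b _ _ hab hba => (lt_asymm hab hba).elim) h1 h2 ?_
    rw [List.perm_ext_iff_of_nodup (h1.imp fun h => h.ne) (h2.imp fun h => h.ne)]
    intro i
    simpa using he i
  rw [List.ofFn_eq_map, List.filter_map, key, List.map_map, List.ofFn_eq_map]
  rfl

/-- If the positive letters of `v`, read from left to right, are `e (g 0) + 1, e (g 1) + 1, …` for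
an increasing `e` whose values all occur, then positive reduction undoes `e`. -/
theorem pos_posRed_ofFn {n d : ℕ} (v : Fin n → ℤ) (e : Fin d ↪o Fin n) (g : Fin d → Fin d)
    (hg : Function.Surjective g)
    (hv : ∀ i, 0 < v i ↔ i ∈ Set.range e) (hvg : ∀ r, v (e r) = (e (g r) : ℕ) + 1) :
    pos (posRed (List.ofFn v)) = List.ofFn fun r => ((g r : ℕ) : ℤ) + 1 := by
  rw [posRed_eq_map, List.map_ofFn, pos, filter_ofFn _ _ e]
  · congr 1
    funext r
    have hset : ((List.ofFn v).toFinset.filter fun y => 0 < y ∧ y ≤ v (e r)) =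
        (Finset.Iic (g r)).image fun t => ((e t : ℕ) : ℤ) + 1 := by
      ext y
      simp only [Finset.mem_filter, List.mem_toFinset, List.mem_ofFn, Finset.mem_image,
        Finset.mem_Iic, hvg]
      constructor
      · rintro ⟨⟨i, rfl⟩, hpos, hle⟩
        obtain ⟨s, rfl⟩ := (hv i).1 hpos
        rw [hvg] at hle ⊢
        refine ⟨g s, ?_, rfl⟩
        rw [← e.le_iff_le, Fin.le_def]
        omega
      · rintro ⟨t, ht, rfl⟩
        obtain ⟨s, rfl⟩ := hg t
        rw [← e.le_iff_le, Fin.le_def] at ht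
        exact ⟨⟨e s, hvg s⟩, by omega, by omega⟩
    have hp : 0 < v (e r) := (hv _).2 ⟨r, rfl⟩
    simp only [Function.comp_apply, reduce, hp, if_true]
    rw [hset, Finset.card_image_of_injective, Fin.card_Iic]
    · push_cast; rfl
    · intro s t hst
      exact e.injective (Fin.ext (by simpa using hst))
  · intro i
    rw [← hv i, decide_eq_true_iff]
    exact reduce_pos_iff (List.mem_ofFn.2 ⟨i, rfl⟩)

end IntWord

/-! ### Blocks between prescribed descents -/

/-- The index of the block containing the position `i` (counted from `0`), when the positions
`0, 1, 2, …` are cut into blocks just before each position in `D`. -/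
def blockIndex (D : Finset ℕ) (i : ℕ) : ℕ := (D.filter (· ≤ i)).card

theorem blockIndex_mono (D : Finset ℕ) : Monotone (blockIndex D) := fun _ _ h =>
  Finset.card_le_card fun _ hx => by
    simp only [Finset.mem_filter] at hx ⊢
    exact ⟨hx.1, hx.2.trans h⟩

theorem blockIndex_lt_succ_iff (D : Finset ℕ) (j : ℕ) :
    blockIndex D j < blockIndex D (j + 1) ↔ j + 1 ∈ D := by
  constructor
  · intro h
    by_contra hj
    refine h.ne (congrArg Finset.card (Finset.filter_congr fun x hx => ?_))
    have : x ≠ j + 1 := fun e => hj (e ▸ hx)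
    show x ≤ j ↔ x ≤ j + 1
    omega
  · intro hj
    refine Finset.card_lt_card ⟨fun x hx => ?_, fun hsub => ?_⟩
    · simp only [Finset.mem_filter] at hx ⊢
      exact ⟨hx.1, hx.2.trans j.le_succ⟩
    · have := @hsub (j + 1) (by simp [hj])
      simp only [Finset.mem_filter] at this
      omega

/-- All descents of `v` lie in `D` exactly when `v` is weakly increasing on each block of `D`. -/
theorem descents_subset_iff_monotone {n : ℕ} (D : Finset ℕ) (v : Fin n → ℤ) :
    (∀ j (h : j + 1 < n), v ⟨j + 1, h⟩ < v ⟨j, Nat.lt_of_succ_lt h⟩ → j + 1 ∈ D) ↔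
      Monotone fun i : Fin n => toLex (blockIndex D i, v i) := by
  cases n with
  | zero => exact ⟨fun _ i => i.elim0, fun _ j h => absurd h (by omega)⟩
  | succ n =>
    rw [Fin.monotone_iff_le_succ]
    have hle (j : ℕ) := blockIndex_mono D (Nat.le_succ j)
    constructor
    · intro H i
      rw [Prod.Lex.toLex_le_toLex]
      have h1 := H i (by omega)
      rw [← blockIndex_lt_succ_iff] at h1
      have h2 := hle i
      simp only [Fin.val_castSucc, Fin.val_succ]
      by_cases h : v i.succ < v i.castSucc
      · exact Or.inl (h1 h)
      · rcases h2.lt_or_eq with h3 | h3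
        · exact Or.inl h3
        · exact Or.inr ⟨h3, not_lt.1 h⟩
    · intro H j h hlt
      have h1 := H ⟨j, by omega⟩
      rw [Prod.Lex.toLex_le_toLex] at h1
      rw [← blockIndex_lt_succ_iff]
      rcases h1 with h1 | h1
      · exact h1
      · exact absurd h1.2 (not_le.2 hlt)

/-! ### Counting by exact descent set -/

theorem card_subset_eq_add_sum {γ : Type*} [Finite γ] (f : γ → Finset ℕ) (D : Finset ℕ) :
    Nat.card {a // f a ⊆ D} =
      Nat.card {a // f a = D} + ∑ E ∈ D.ssubsets, Nat.card {a // f a = E} := by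
  classical
  have := Fintype.ofFinite γ
  simp only [Nat.card_eq_fintype_card, Fintype.card_subtype]
  rw [Finset.card_eq_sum_card_fiberwise (f := f) (t := D.powerset), ← Finset.insert_erase
    (Finset.mem_powerset_self D), Finset.sum_insert (by simp)]
  · congr 1
    · congr 1
      ext a
      simp only [Finset.mem_filter, Finset.mem_univ, true_and]
      exact ⟨fun h => h.2, fun h => ⟨h.subset, h⟩⟩
    · refine Finset.sum_congr rfl fun E hE => ?_
      have hE : E ⊆ D := Finset.mem_powerset.1 (Finset.mem_of_mem_erase hE)
      congr 1
      ext a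
      simp only [Finset.mem_filter, Finset.mem_univ, true_and]
      exact ⟨fun h => h.2, fun h => ⟨h ▸ hE, h⟩⟩
  · intro a ha
    simpa using ha

/-- Inclusion–exclusion: the numbers of objects whose set is contained in `D`, for all `D`,
determine the numbers of objects whose set equals `D`. -/
theorem card_fiber_eq_of_card_subset_eq {α β : Type*} [Finite α] [Finite β]
    (f : α → Finset ℕ) (g : β → Finset ℕ)
    (h : ∀ D, Nat.card {a // f a ⊆ D} = Nat.card {b // g b ⊆ D}) (D : Finset ℕ) :
    Nat.card {a // f a = D} = Nat.card {b // g b = D} := by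
  induction D using Finset.strongInduction with
  | H D ih =>
    have h1 := h D
    rw [card_subset_eq_add_sum f, card_subset_eq_add_sum g,
      Finset.sum_congr rfl fun E hE => ih E (Finset.mem_ssubsets.1 hE)] at h1
    exact Nat.add_right_cancel h1

/-! ### Code words and blockwise sorting -/

/-- A word of length `n` whose letters are colours `Sum.inl c` and the markers
`Sum.inr 0, …, Sum.inr (d - 1)`, each marker occurring exactly once and in increasing order. The
marker `Sum.inr r` stands for the `r`-th non-fixed letter of an arrangement. -/
structure CodeWord (n k d : ℕ) where
  /-- the letters -/
  letter : Fin n → Fin k ⊕ Fin d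
  /-- the positions of the markers -/
  pos : Fin d ↪o Fin n
  letter_eq_inr_iff : ∀ i r, letter i = Sum.inr r ↔ pos r = i

namespace CodeWord

variable {n k d : ℕ}

theorem letter_pos (x : CodeWord n k d) (r : Fin d) : x.letter (x.pos r) = Sum.inr r :=
  (x.letter_eq_inr_iff _ _).2 rfl

theorem ext_letter {x y : CodeWord n k d} (h : x.letter = y.letter) : x = y := by
  obtain ⟨x, e, he⟩ := x
  obtain ⟨y, e', he'⟩ := y
  obtain rfl : x = y := h
  obtain rfl : e = e' := by
    ext r : 1
    exact ((he _ _).1 ((he' _ _).2 rfl))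
  rfl

instance : Finite (CodeWord n k d) :=
  Finite.of_injective (fun x : CodeWord n k d => x.letter) fun _ _ h => ext_letter h

/-- The number of occurrences of a colour. -/
def count (x : CodeWord n k d) (c : Fin k) : ℕ :=
  (Finset.univ.filter fun i => x.letter i = Sum.inl c).card

/-- The word is weakly increasing on each block of `D`, letters being compared by `key`. -/
def BlockSorted (D : Finset ℕ) (key : Fin k ⊕ Fin d → ℤ) (x : CodeWord n k d) : Prop :=
  Monotone fun i : Fin n => toLex (blockIndex D i, key (x.letter i))

theorem BlockSorted.key_le {D : Finset ℕ} {key : Fin k ⊕ Fin d → ℤ} {x : CodeWord n k d}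
    (hx : x.BlockSorted D key) {i j : Fin n} (hij : i ≤ j)
    (hb : blockIndex D i = blockIndex D j) : key (x.letter i) ≤ key (x.letter j) := by
  have := hx hij
  rw [Prod.Lex.toLex_le_toLex] at this
  rcases this with h | h
  · exact absurd h (by simp [hb])
  · exact h.2

/-- Two orders on the letters agree on the markers of each block of a word sorted by the first. -/
def Compatible (keyA keyB : Fin k ⊕ Fin d → ℤ) : Prop :=
  ∀ (n : ℕ) (D : Finset ℕ) (x : CodeWord n k d), x.BlockSorted D keyA → ∀ s r : Fin d, s < r →
    blockIndex D (x.pos s) = blockIndex D (x.pos r) → keyB (Sum.inr s) < keyB (Sum.inr r)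

/-- Sorting each block by `keyB`. Compatibility keeps the markers in increasing order. -/
theorem exists_blockSorted_perm {D : Finset ℕ} {keyA keyB : Fin k ⊕ Fin d → ℤ}
    (hc : Compatible keyA keyB) (x : CodeWord n k d) (hx : x.BlockSorted D keyA) :
    ∃ (σ : Equiv.Perm (Fin n)) (y : CodeWord n k d), y.letter = x.letter ∘ σ ∧
      (∀ i, blockIndex D (σ i) = blockIndex D i) ∧ y.BlockSorted D keyB := by
  set f : Fin n → ℕ ×ₗ ℤ := fun i => toLex (blockIndex D i, keyB (x.letter i)) with hf
  set σ := Tuple.sort f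
  have hs : Monotone (f ∘ σ) := Tuple.monotone_sort f
  have hblk (i : Fin n) : blockIndex D (σ i) = blockIndex D i := by
    have h1 : Monotone ((fun i : Fin n => blockIndex D i) ∘ σ) := fun i j hij =>
      Prod.Lex.monotone_fst _ _ (hs hij)
    have h2 : Monotone ((fun i : Fin n => blockIndex D i) ∘ (1 : Equiv.Perm (Fin n))) :=
      fun i j hij => blockIndex_mono D hij
    exact congrFun (Tuple.unique_monotone h1 h2) i
  have hmono : StrictMono fun r => σ.symm (x.pos r) := by
    intro r s hrs
    by_contra hle
    have hle : σ.symm (x.pos s) ≤ σ.symm (x.pos r) := not_lt.1 hle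
    have hb : blockIndex D (x.pos r) = blockIndex D (x.pos s) := by
      refine le_antisymm (blockIndex_mono D (x.pos.monotone hrs.le)) ?_
      have := blockIndex_mono D (Fin.le_def.1 hle)
      rwa [← hblk, ← hblk (σ.symm _), Equiv.apply_symm_apply, Equiv.apply_symm_apply] at this
    have h := hs hle
    simp only [hf, Function.comp_apply, Equiv.apply_symm_apply, letter_pos] at h
    rw [Prod.Lex.toLex_le_toLex] at h
    rcases h with h | h
    · exact absurd h (by simp [hb])
    · exact absurd h.2 (not_le.2 (hc n D x hx r s hrs hb))
  refine ⟨σ, ⟨x.letter ∘ σ, OrderEmbedding.ofStrictMono _ hmono, fun i r => ?_⟩, rfl, hblk, ?_⟩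
  · rw [Function.comp_apply, x.letter_eq_inr_iff]
    exact σ.symm_apply_eq.symm
  · intro i j hij
    have h := hs hij
    simp only [hf, Function.comp_apply, hblk] at h
    exact h

theorem count_comp_perm {x y : CodeWord n k d} {σ : Equiv.Perm (Fin n)}
    (h : y.letter = x.letter ∘ σ) (c : Fin k) : y.count c = x.count c := by
  refine Finset.card_bij (fun i _ => σ i) ?_ (fun _ _ _ _ h => σ.injective h) fun j hj => ?_
  · intro i hi
    simpa [h] using hi
  · exact ⟨σ.symm j, by simpa [h] using hj, by simp⟩

/-- A word sorted in blocks is determined by the contents of its blocks, so that blockwise sorting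
by another order is injective. -/
theorem card_blockSorted_le {D : Finset ℕ} {keyA keyB : Fin k ⊕ Fin d → ℤ}
    (hA : Function.Injective keyA) (hc : Compatible keyA keyB) (m : Fin k → ℕ) :
    Nat.card {x : CodeWord n k d // (∀ c, x.count c = m c) ∧ x.BlockSorted D keyA} ≤
      Nat.card {x : CodeWord n k d // (∀ c, x.count c = m c) ∧ x.BlockSorted D keyB} := by
  choose σ y hy hblk hsort using fun x : {x : CodeWord n k d //
    (∀ c, x.count c = m c) ∧ x.BlockSorted D keyA} => exists_blockSorted_perm hc x.1 x.2.2
  refine Nat.card_le_card_of_injective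
    (fun x => ⟨y x, fun c => (count_comp_perm (hy x) c).trans (x.2.1 c), hsort x⟩) ?_
  intro x x' h
  have h : y x = y x' := congrArg Subtype.val h
  set f := fun i : Fin n => toLex (blockIndex D i, keyA (x.1.letter i)) with hf
  set f' := fun i : Fin n => toLex (blockIndex D i, keyA (x'.1.letter i)) with hf'
  have e : f ∘ σ x = f' ∘ σ x' := by
    funext i
    have := congrFun ((hy x).symm.trans ((congrArg letter h).trans (hy x'))) i
    simp only [Function.comp_apply] at this
    simp only [hf, hf', Function.comp_apply, hblk, this]
  have e2 : f' = f ∘ ((σ x')⁻¹.trans (σ x) : Equiv.Perm (Fin n)) := by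
    funext i
    have := congrFun e ((σ x')⁻¹ i)
    simpa using this.symm
  have e3 : f ∘ (1 : Equiv.Perm (Fin n)) = f' := by
    rw [e2]
    refine Tuple.unique_monotone x.2.2 ?_
    rw [← e2]
    exact x'.2.2
  refine Subtype.ext (ext_letter (funext fun i => hA ?_))
  exact (Prod.ext_iff.1 (toLex.injective (congrFun e3 i))).2

/-! ### The two orders on the letters -/

variable (τ : Equiv.Perm (Fin k)) (δ : Equiv.Perm (Fin d))

/-- The order in which the letters of the derangement form are compared: the letter `inl c` stands
for the colour `τ c`, and the markers for the letters of the derangement `δ`. -/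
def derKey : Fin k ⊕ Fin d → ℤ
  | Sum.inl c => -((τ c : ℕ) + 1)
  | Sum.inr r => (δ r : ℕ) + 1

/-- The order in which the letters of the permutation form are compared. In an increasing run of a
permutation, the fixed points come after the letters that lie below the diagonal and before those
above it, so the last colour is put between the markers `r` with `δ r < r` and the others. -/
def permKey : Fin k ⊕ Fin d → ℤ
  | Sum.inl c => if (c : ℕ) + 1 = k then d + 1 else -((c : ℕ) + 1)
  | Sum.inr r => if δ r < r then (δ r : ℕ) + 1 else d + 2 + (δ r : ℕ)

theorem derKey_injective : Function.Injective (derKey τ δ) := by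
  rintro (c | r) (c' | r') h <;> simp only [derKey] at h
  · exact congrArg _ (τ.injective (Fin.ext (by omega)))
  · omega
  · omega
  · exact congrArg _ (δ.injective (Fin.ext (by omega)))

theorem permKey_injective : Function.Injective (permKey (k := k) δ) := by
  rintro (c | r) (c' | r') h <;> simp only [permKey] at h
  · exact congrArg _ (Fin.ext (by split_ifs at h <;> omega))
  · have := (δ r').isLt
    split_ifs at h <;> omega
  · have := (δ r).isLt
    split_ifs at h <;> omega
  · have := (δ r).isLt
    have := (δ r').isLt
    exact congrArg _ (δ.injective (Fin.ext (by split_ifs at h <;> omega)))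

/-- On the markers of one block `δ` is increasing, so an excedance of `δ` can only be followed by
excedances. -/
theorem compatible_derKey_permKey : Compatible (derKey τ δ) (permKey δ) := by
  intro n D x hx s r hsr hb
  have hlt : ∀ t u : Fin d, s ≤ t → t < u → u ≤ r → (δ t : ℕ) < δ u := by
    intro t u hst htu hur
    have hbtu : blockIndex D (x.pos t) = blockIndex D (x.pos u) := by
      have h1 := blockIndex_mono D (Fin.le_def.1 (x.pos.monotone hst))
      have h2 := blockIndex_mono D (Fin.le_def.1 (x.pos.monotone htu.le))
      have h3 := blockIndex_mono D (Fin.le_def.1 (x.pos.monotone hur))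
      omega
    have h := hx.key_le (x.pos.monotone htu.le) hbtu
    simp only [letter_pos, derKey] at h
    have hne : (δ t : ℕ) ≠ δ u := fun e => htu.ne (δ.injective (Fin.ext e))
    omega
  have hstep : ∀ (l : ℕ) (h : (s : ℕ) + l < d), (s : ℕ) + l ≤ r →
      (δ s : ℕ) + l ≤ δ ⟨s + l, h⟩ := by
    intro l
    induction l with
    | zero => intro h _; exact le_rfl
    | succ l ih =>
      intro h hle
      have h1 := ih (by omega) (by omega)
      have h2 := hlt ⟨s + l, by omega⟩ ⟨s + (l + 1), h⟩ (Fin.le_def.2 (by simp))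
        (Fin.lt_def.2 (by simp)) (Fin.le_def.2 hle)
      omega
  have h1 := hlt s r le_rfl hsr le_rfl
  have hsr' : (s : ℕ) < r := hsr
  have h2 := hstep (r - s) (by omega) (by omega)
  simp only [Nat.add_sub_of_le hsr'.le, Fin.eta] at h2
  have := (δ s).isLt
  simp only [permKey, Fin.lt_def]
  split_ifs <;> omega

theorem compatible_permKey_derKey (hδ : ∀ r, δ r ≠ r) :
    Compatible (permKey δ) (derKey τ δ) := by
  intro n D x hx s r hsr hb
  have h := hx.key_le (x.pos.monotone hsr.le) hb
  have hne : (δ s : ℕ) ≠ δ r := fun e => hsr.ne (δ.injective (Fin.ext e))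
  have hr : (δ r : ℕ) ≠ r := fun e => hδ r (Fin.ext e)
  have hsr' : (s : ℕ) < r := hsr
  have := (δ r).isLt
  simp only [letter_pos, permKey, Fin.lt_def] at h
  simp only [derKey]
  split_ifs at h <;> omega

end CodeWord

/-! ### Arrangements and their code words -/

namespace KArrangement

variable {n k d : ℕ}

theorem ext_color {a b : KArrangement n k} (h : a.perm = b.perm)
    (hc : ∀ i h h', a.color ⟨i, h⟩ = b.color ⟨i, h'⟩) : a = b := by
  obtain ⟨π, φ⟩ := a
  obtain ⟨π', φ'⟩ := b
  obtain rfl : π = π' := h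
  obtain rfl : φ = φ' := funext fun i => hc i.1 i.2 i.2
  rfl

instance : Finite (KArrangement n k) :=
  Finite.of_injective
    (fun a : KArrangement n k =>
      (⟨a.perm, a.color⟩ : Σ π : Equiv.Perm (Fin n), {i : Fin n // π i = i} → Fin k))
    fun a b h => by
      obtain ⟨π, φ⟩ := a
      obtain ⟨π', φ'⟩ := b
      cases h
      rfl

/-- The letter at position `i` of the word whose positive reduction is the derangement form. -/
def derLetter (a : KArrangement n k) (i : Fin n) : ℤ :=
  if h : a.perm i = i then -(((a.color ⟨i, h⟩ : ℕ) : ℤ) + 1) else ((a.perm i : ℕ) : ℤ) + 1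

/-- The letter at position `i` of the word whose positive reduction is the permutation form. -/
def permLetter (a : KArrangement n k) (i : Fin n) : ℤ :=
  if h : a.perm i = i ∧ ∀ h' : a.perm i = i, (a.color ⟨i, h'⟩ : ℕ) + 1 ≠ k then
    -(((a.color ⟨i, h.1⟩ : ℕ) : ℤ) + 1)
  else ((a.perm i : ℕ) : ℤ) + 1

theorem DEZ_eq (a : KArrangement n k) : a.DEZ = IntWord.desSet (List.ofFn a.derLetter) :=
  IntWord.desSet_posRed _

theorem DES_eq (a : KArrangement n k) : a.DES = IntWord.desSet (List.ofFn a.permLetter) :=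
  IntWord.desSet_posRed _

/-- If `e` enumerates the non-fixed points of `a` in increasing order, then `Der a` is the
permutation induced on the non-fixed points. -/
theorem Der_eq (a : KArrangement n k) (e : Fin d ↪o Fin n) (δ : Equiv.Perm (Fin d))
    (he : ∀ i, a.perm i ≠ i ↔ i ∈ Set.range e) (hδ : ∀ r, a.perm (e r) = e (δ r)) :
    a.Der = List.ofFn fun r => ((δ r : ℕ) : ℤ) + 1 := by
  refine IntWord.pos_posRed_ofFn a.derLetter e δ δ.surjective (fun i => ?_) fun r => ?_
  · rw [← he, derLetter]
    split_ifs with h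
    · simp only [h, ne_eq, not_true_eq_false, iff_false]
      omega
    · simp only [ne_eq, h, not_false_eq_true, iff_true]
      omega
  · rw [derLetter, dif_neg ((he _).2 ⟨r, rfl⟩), hδ]

theorem exists_enum_nonfixed (a : KArrangement n k) :
    ∃ (d : ℕ) (e : Fin d ↪o Fin n) (δ : Equiv.Perm (Fin d)),
      (∀ i, a.perm i ≠ i ↔ i ∈ Set.range e) ∧ ∀ r, a.perm (e r) = e (δ r) := by
  set N := Finset.univ.filter fun i => a.perm i ≠ i with hN
  have he : ∀ i, a.perm i ≠ i ↔ i ∈ Set.range (N.orderEmbOfFin rfl) := by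
    intro i
    simp [Finset.range_orderEmbOfFin, hN]
  have hex : ∀ r, ∃ s, N.orderEmbOfFin rfl s = a.perm (N.orderEmbOfFin rfl r) := by
    intro r
    refine (he _).1 fun h => ?_
    exact (he _).2 ⟨r, rfl⟩ (a.perm.injective h)
  choose g hg using hex
  have hinj : Function.Injective g := by
    intro r s hrs
    refine (N.orderEmbOfFin rfl).injective (a.perm.injective ?_)
    rw [← hg, ← hg, hrs]
  exact ⟨_, N.orderEmbOfFin rfl, Equiv.ofBijective g (Finite.injective_iff_bijective.1 hinj), he,
    fun r => (hg r).symm⟩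

end KArrangement

namespace CodeWord

open KArrangement

variable {n k d : ℕ}

theorem letter_isLeft_iff (x : CodeWord n k d) (i : Fin n) :
    (x.letter i).isLeft ↔ i ∉ Set.range x.pos := by
  rcases h : x.letter i with c | r
  · simp only [Sum.isLeft_inl, true_iff]
    rintro ⟨r, rfl⟩
    simp [letter_pos] at h
  · have := (x.letter_eq_inr_iff i r).1 h
    simp [← this]

variable (τ : Equiv.Perm (Fin k)) (δ : Equiv.Perm (Fin d))

theorem viaEmbedding_pos (x : CodeWord n k d) (r : Fin d) :
    δ.viaEmbedding x.pos.toEmbedding (x.pos r) = x.pos (δ r) :=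
  δ.viaEmbedding_apply x.pos.toEmbedding r

theorem viaEmbedding_eq_self_iff {δ : Equiv.Perm (Fin d)} (hδ : ∀ r, δ r ≠ r)
    (x : CodeWord n k d)
    (i : Fin n) : δ.viaEmbedding x.pos.toEmbedding i = i ↔ i ∉ Set.range x.pos := by
  constructor
  · rintro h ⟨r, rfl⟩
    rw [viaEmbedding_pos] at h
    exact hδ r (x.pos.injective h)
  · intro h
    exact δ.viaEmbedding_apply_of_notMem x.pos.toEmbedding i h

variable {δ} (hδ : ∀ r, δ r ≠ r)

/-- The arrangement with derangement part `δ` described by a code word: the fixed points are the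
positions of the colours, and the letter `inl c` gives the colour `τ c`. -/
noncomputable def decode (x : CodeWord n k d) : KArrangement n k where
  perm := δ.viaEmbedding x.pos.toEmbedding
  color i := τ ((x.letter i).getLeft
    ((x.letter_isLeft_iff i).2 ((viaEmbedding_eq_self_iff hδ x i).1 i.2)))

theorem decode_perm_pos (x : CodeWord n k d) (r : Fin d) :
    (x.decode τ hδ).perm (x.pos r) = x.pos (δ r) := viaEmbedding_pos δ x r

theorem decode_nonfixed_iff (x : CodeWord n k d) (i : Fin n) :
    (x.decode τ hδ).perm i ≠ i ↔ i ∈ Set.range x.pos :=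
  not_iff_comm.1 (viaEmbedding_eq_self_iff hδ x i).symm

theorem letter_of_decode_fixed (x : CodeWord n k d) (i : Fin n)
    (h : (x.decode τ hδ).perm i = i) :
    x.letter i = Sum.inl (τ.symm ((x.decode τ hδ).color ⟨i, h⟩)) := by
  simp [decode]

theorem decode_fixed_of_letter (x : CodeWord n k d) {i : Fin n} {c : Fin k}
    (hi : x.letter i = Sum.inl c) :
    ∃ h : (x.decode τ hδ).perm i = i, (x.decode τ hδ).color ⟨i, h⟩ = τ c := by
  have h : (x.decode τ hδ).perm i = i :=
    (viaEmbedding_eq_self_iff hδ x i).2 ((x.letter_isLeft_iff i).1 (by simp [hi]))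
  refine ⟨h, ?_⟩
  have := x.letter_of_decode_fixed τ hδ i h
  rw [hi] at this
  simp [Sum.inl.inj this]

theorem decode_nonfixed_of_letter (x : CodeWord n k d) {i : Fin n} {r : Fin d}
    (hi : x.letter i = Sum.inr r) : (x.decode τ hδ).perm i ≠ i :=
  (x.decode_nonfixed_iff τ hδ i).2 ⟨r, (x.letter_eq_inr_iff i r).1 hi⟩

theorem Der_decode (x : CodeWord n k d) :
    (x.decode τ hδ).Der = List.ofFn fun r => ((δ r : ℕ) : ℤ) + 1 :=
  Der_eq _ x.pos δ (x.decode_nonfixed_iff τ hδ) (x.decode_perm_pos τ hδ)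

theorem fixCount_decode (x : CodeWord n k d) (c : Fin k) :
    (x.decode τ hδ).fixCount (τ c) = x.count c := by
  refine Finset.card_bij (fun i _ => i.1) ?_ (fun _ _ _ _ h => Subtype.ext h) ?_
  · rintro ⟨i, h⟩ hi
    simp only [Finset.mem_filter, Finset.mem_univ, true_and] at hi ⊢
    rw [x.letter_of_decode_fixed τ hδ i h, hi, Equiv.symm_apply_apply]
  · intro i hi
    simp only [Finset.mem_filter, Finset.mem_univ, true_and] at hi
    obtain ⟨h, hc⟩ := x.decode_fixed_of_letter τ hδ hi
    exact ⟨⟨i, h⟩, by simpa using hc, rfl⟩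

theorem decode_injective : Function.Injective (decode (n := n) τ hδ) := by
  intro x y h
  have hrange : Set.range x.pos = Set.range y.pos := by
    ext i
    rw [← decode_nonfixed_iff τ hδ, ← decode_nonfixed_iff τ hδ, h]
  have hpos : ⇑x.pos = y.pos := (x.pos.strictMono.range_inj y.pos.strictMono).1 hrange
  refine ext_letter (funext fun i => ?_)
  rcases hi : x.letter i with c | r
  · obtain ⟨h1, h2⟩ : ∃ h : (y.decode τ hδ).perm i = i,
        (y.decode τ hδ).color ⟨i, h⟩ = τ c := h ▸ x.decode_fixed_of_letter τ hδ hi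
    rw [y.letter_of_decode_fixed τ hδ i h1, h2, Equiv.symm_apply_apply]
  · rw [x.letter_eq_inr_iff, hpos] at hi
    exact ((y.letter_eq_inr_iff i r).2 hi).symm

theorem exists_decode_eq (a : KArrangement n k)
    (ha : a.Der = List.ofFn fun r => ((δ r : ℕ) : ℤ) + 1) :
    ∃ x : CodeWord n k d, x.decode τ hδ = a := by
  obtain ⟨d', e, δ', he, hδ'⟩ := a.exists_enum_nonfixed
  rw [Der_eq a e δ' he hδ'] at ha
  obtain rfl : d' = d := by simpa using congrArg List.length ha
  obtain rfl : δ' = δ := by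
    ext r
    simpa using congrFun (List.ofFn_injective ha) r
  have hr (i : Fin n) (h : ¬ a.perm i = i) : ∃ r, e r = i := (he i).1 h
  choose r hr using hr
  let x : CodeWord n k d' :=
    { letter := fun i =>
        if h : a.perm i = i then Sum.inl (τ.symm (a.color ⟨i, h⟩)) else Sum.inr (r i h)
      pos := e
      letter_eq_inr_iff := by
        intro i s
        split_ifs with h
        · simp only [false_iff]
          rintro rfl
          exact (he _).2 ⟨s, rfl⟩ h
        · rw [Sum.inr.injEq, ← e.injective.eq_iff, hr, eq_comm] }
  have hperm : (x.decode τ hδ).perm = a.perm := by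
    ext i : 1
    by_cases h : a.perm i = i
    · rw [h]
      by_contra h'
      exact (he i).2 ((x.decode_nonfixed_iff τ hδ i).1 h') h
    · obtain ⟨s, rfl⟩ := (he i).1 h
      rw [hδ']
      exact x.decode_perm_pos τ hδ s
  refine ⟨x, ext_color hperm fun i h h' => ?_⟩
  have h1 := x.letter_of_decode_fixed τ hδ i h
  have h2 : x.letter i = Sum.inl (τ.symm (a.color ⟨i, h'⟩)) := dif_pos h'
  exact τ.symm.injective (Sum.inl.inj (h1.symm.trans h2))

/-! ### Descents in terms of code words -/

theorem derLetter_decode_lt_iff (x : CodeWord n k d) (i j : Fin n) :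
    (x.decode τ hδ).derLetter j < (x.decode τ hδ).derLetter i ↔
      derKey τ δ (x.letter j) < derKey τ δ (x.letter i) := by
  have hL {i : Fin n} {c : Fin k} (hi : x.letter i = Sum.inl c) :
      (x.decode τ hδ).derLetter i = -((τ c : ℕ) + 1) := by
    obtain ⟨h, hc⟩ := x.decode_fixed_of_letter τ hδ hi
    rw [derLetter, dif_pos h, hc]
  have hR {i : Fin n} {r : Fin d} (hi : x.letter i = Sum.inr r) :
      (x.decode τ hδ).derLetter i = (x.pos (δ r) : ℕ) + 1 := by
    rw [derLetter, dif_neg (x.decode_nonfixed_of_letter τ hδ hi),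
      ← (x.letter_eq_inr_iff i r).1 hi, decode_perm_pos]
  rcases hi : x.letter i with c | r <;> rcases hj : x.letter j with c' | r'
  · rw [hL hi, hL hj, derKey, derKey]
  · rw [hL hi, hR hj, derKey, derKey]
    omega
  · rw [hR hi, hL hj, derKey, derKey]
    omega
  · have := x.pos.lt_iff_lt (a := δ r') (b := δ r)
    rw [Fin.lt_def, Fin.lt_def] at this
    rw [hR hi, hR hj, derKey, derKey]
    omega

theorem DEZ_decode_subset_iff (x : CodeWord n k d) (D : Finset ℕ) :
    (x.decode τ hδ).DEZ ⊆ D ↔ x.BlockSorted D (derKey τ δ) := by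
  rw [DEZ_eq, IntWord.desSet_ofFn_subset_iff, BlockSorted,
    ← descents_subset_iff_monotone D fun i => derKey τ δ (x.letter i)]
  simp only [derLetter_decode_lt_iff, Finset.mem_coe]

/-- At the neighbouring positions `i` and `i + 1`, a letter below the diagonal is at most `i` and a
letter above it at least `i + 1`; a fixed point at one of them is a value that the other does not
take. So a comparison involving a kept fixed point, or two letters on different sides of the
diagonal, depends only on the sides. For positions that are not adjacent this can fail. -/
theorem permLetter_decode_lt_iff (x : CodeWord n k d) (i j : Fin n) (hij : (j : ℕ) = i + 1) :
    (x.decode 1 hδ).permLetter j < (x.decode 1 hδ).permLetter i ↔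
      permKey δ (x.letter j) < permKey δ (x.letter i) := by
  have hL {i : Fin n} {c : Fin k} (hi : x.letter i = Sum.inl c) :
      (x.decode 1 hδ).permLetter i = if (c : ℕ) + 1 = k then (i : ℤ) + 1 else -((c : ℕ) + 1) := by
    obtain ⟨h, hc⟩ := x.decode_fixed_of_letter 1 hδ hi
    rw [Equiv.Perm.one_apply] at hc
    split_ifs with hk
    · rw [permLetter, dif_neg, h]
      rintro ⟨_, h'⟩
      exact h' h (by rw [hc, hk])
    · rw [permLetter, dif_pos ⟨h, fun _ => by rwa [hc]⟩, hc]
  have hR {i : Fin n} {r : Fin d} (hi : x.letter i = Sum.inr r) :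
      (x.decode 1 hδ).permLetter i = (x.pos (δ r) : ℕ) + 1 ∧ (x.pos r : ℕ) = i ∧
        ((δ r < r ∧ (x.pos (δ r) : ℕ) < x.pos r) ∨
          (¬ δ r < r ∧ (x.pos r : ℕ) < x.pos (δ r))) := by
    refine ⟨?_, congrArg _ ((x.letter_eq_inr_iff i r).1 hi), ?_⟩
    · rw [permLetter, dif_neg fun h => x.decode_nonfixed_of_letter 1 hδ hi h.1,
        ← (x.letter_eq_inr_iff i r).1 hi, decode_perm_pos]
    · rcases lt_or_gt_of_ne (hδ r) with h | h
      · exact Or.inl ⟨h, x.pos.strictMono h⟩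
      · exact Or.inr ⟨h.asymm, x.pos.strictMono h⟩
  rcases hi : x.letter i with c | r <;> rcases hj : x.letter j with c' | r'
  · rw [hL hi, hL hj, permKey, permKey]
    split_ifs <;> omega
  · obtain ⟨h1, h2, h3⟩ := hR hj
    have := (δ r').isLt
    have hne : (x.pos (δ r') : ℕ) ≠ i := fun e => by
      rw [(x.letter_eq_inr_iff i (δ r')).2 (Fin.ext e)] at hi
      cases hi
    rw [hL hi, h1, permKey, permKey]
    rcases h3 with h3 | h3 <;> simp only [h3.1, if_true, if_false] <;> split_ifs <;> omega
  · obtain ⟨h1, h2, h3⟩ := hR hi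
    have := (δ r).isLt
    rw [hL hj, h1, permKey, permKey]
    have hne : (x.pos (δ r) : ℕ) ≠ j := fun e => by
      rw [(x.letter_eq_inr_iff j (δ r)).2 (Fin.ext e)] at hj
      cases hj
    rcases h3 with h3 | h3 <;> simp only [h3.1, if_true, if_false] <;> split_ifs <;> omega
  · obtain ⟨h1, h2, h3⟩ := hR hi
    obtain ⟨h1', h2', h3'⟩ := hR hj
    have := (δ r).isLt
    have := (δ r').isLt
    have := x.pos.lt_iff_lt (a := δ r') (b := δ r)
    rw [Fin.lt_def, Fin.lt_def] at this
    rw [h1, h1', permKey, permKey]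
    rcases h3 with h3 | h3 <;> rcases h3' with h3' | h3' <;>
      simp only [h3.1, h3'.1, if_true, if_false] <;> omega

theorem DES_decode_subset_iff (x : CodeWord n k d) (D : Finset ℕ) :
    (x.decode 1 hδ).DES ⊆ D ↔ x.BlockSorted D (permKey δ) := by
  rw [DES_eq, IntWord.desSet_ofFn_subset_iff, BlockSorted,
    ← descents_subset_iff_monotone D fun i => permKey δ (x.letter i)]
  refine forall_congr' fun j => forall_congr' fun h => ?_
  rw [x.permLetter_decode_lt_iff hδ _ _ rfl, Finset.mem_coe]

end CodeWord

/-! ### Equidistribution and the bijection -/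

namespace KArrangement

variable {n k d : ℕ}

/-- Arrangements with derangement part `δ` correspond to code words. -/
theorem card_eq_card_codeWord {δ : Equiv.Perm (Fin d)} (hδ : ∀ r, δ r ≠ r)
    (τ : Equiv.Perm (Fin k)) (m : Fin k → ℕ) (P : KArrangement n k → Prop)
    (Q : CodeWord n k d → Prop) (hPQ : ∀ x : CodeWord n k d, P (x.decode τ hδ) ↔ Q x) :
    Nat.card {a : {a : withMult n m // a.1.Der = List.ofFn fun r => ((δ r : ℕ) : ℤ) + 1} //
        P a.1.1} =
      Nat.card {x : CodeWord n k d // (∀ c, x.count c = m (τ c)) ∧ Q x} := by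
  symm
  refine Nat.card_congr (Equiv.ofBijective (fun x => ⟨⟨⟨x.1.decode τ hδ, fun c => ?_⟩,
    x.1.Der_decode τ hδ⟩, (hPQ x.1).2 x.2.2⟩) ⟨fun x y h => ?_, ?_⟩)
  · obtain ⟨c, rfl⟩ := τ.surjective c
    rw [CodeWord.fixCount_decode, x.2.1]
  · exact Subtype.ext (CodeWord.decode_injective τ hδ
      (congrArg (fun a => (a.1.1.1 : KArrangement n k)) h))
  · rintro ⟨⟨⟨a, ha⟩, hDer⟩, hP⟩
    obtain ⟨x, rfl⟩ := CodeWord.exists_decode_eq τ hδ a hDer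
    refine ⟨⟨x, fun c => ?_, (hPQ x).1 hP⟩, rfl⟩
    rw [← CodeWord.fixCount_decode τ hδ]
    exact ha (τ c)

/-- Among the arrangements with a given derangement part, `DEZ ⊆ D` in content `m` and `DES ⊆ D` in
content `m ∘ τ` are equally frequent. -/
theorem card_DEZ_subset_eq_card_DES_subset (m : Fin k → ℕ) (τ : Equiv.Perm (Fin k)) (w : IntWord)
    (D : Finset ℕ) :
    Nat.card {a : {a : withMult n m // a.1.Der = w} // a.1.1.DEZ ⊆ D} =
      Nat.card {a : {a : withMult n (fun i => m (τ i)) // a.1.Der = w} // a.1.1.DES ⊆ D} := by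
  by_cases h : ∃ (d : ℕ) (δ : Equiv.Perm (Fin d)), (∀ r, δ r ≠ r) ∧
      w = List.ofFn fun r => ((δ r : ℕ) : ℤ) + 1
  · obtain ⟨d, δ, hδ, rfl⟩ := h
    rw [card_eq_card_codeWord hδ τ m (fun a => a.DEZ ⊆ D) _ fun x => x.DEZ_decode_subset_iff τ hδ D,
      card_eq_card_codeWord hδ 1 _ (fun a => a.DES ⊆ D) _ fun x => x.DES_decode_subset_iff hδ D]
    exact le_antisymm
      (CodeWord.card_blockSorted_le (CodeWord.derKey_injective τ δ)
        (CodeWord.compatible_derKey_permKey τ δ) _)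
      (CodeWord.card_blockSorted_le (CodeWord.permKey_injective δ)
        (CodeWord.compatible_permKey_derKey τ δ hδ) _)
  · have hempty (a : KArrangement n k) : a.Der ≠ w := by
      rintro rfl
      obtain ⟨d, e, δ, he, hδ⟩ := a.exists_enum_nonfixed
      refine h ⟨d, δ, fun r hr => ?_, a.Der_eq e δ he hδ⟩
      exact (he (e r)).2 ⟨r, rfl⟩ (by rw [hδ, hr])
    have (m' : Fin k → ℕ) : IsEmpty {a : withMult n m' // a.1.Der = w} :=
      ⟨fun a => hempty _ a.2⟩
    rw [Nat.card_of_isEmpty, Nat.card_of_isEmpty]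

theorem DEZ_subset_range (a : KArrangement n k) : a.DEZ ⊆ Finset.range n := by
  rw [DEZ_eq]
  exact IntWord.desSet_ofFn_subset_range _

theorem DES_subset_range (a : KArrangement n k) : a.DES ⊆ Finset.range n := by
  rw [DES_eq]
  exact IntWord.desSet_ofFn_subset_range _

/-- `DEZ` as a finite set. -/
noncomputable def finDEZ (a : KArrangement n k) : Finset ℕ :=
  ((Finset.finite_toSet _).subset a.DEZ_subset_range).toFinset

/-- `DES` as a finite set. -/
noncomputable def finDES (a : KArrangement n k) : Finset ℕ :=
  ((Finset.finite_toSet _).subset a.DES_subset_range).toFinset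

@[simp] theorem coe_finDEZ (a : KArrangement n k) : (a.finDEZ : Set ℕ) = a.DEZ :=
  Set.Finite.coe_toFinset _

@[simp] theorem coe_finDES (a : KArrangement n k) : (a.finDES : Set ℕ) = a.DES :=
  Set.Finite.coe_toFinset _

theorem card_DEZ_eq_card_DES (m : Fin k → ℕ) (τ : Equiv.Perm (Fin k)) (w : IntWord)
    (D : Finset ℕ) :
    Nat.card {a : {a : withMult n m // a.1.Der = w} // a.1.1.finDEZ = D} =
      Nat.card {a : {a : withMult n (fun i => m (τ i)) // a.1.Der = w} // a.1.1.finDES = D} := by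
  refine card_fiber_eq_of_card_subset_eq _ _ (fun E => ?_) D
  simp only [← Finset.coe_subset, coe_finDEZ, coe_finDES]
  exact card_DEZ_subset_eq_card_DES_subset m τ w E

end KArrangement

theorem theorem1p1 (n k : ℕ) (hn : 1 ≤ n) (hk : 1 ≤ k) (m : Fin k → ℕ)
    (τ : Equiv.Perm (Fin k)) :
    ∃ Φ : KArrangement.withMult n m → KArrangement.withMult n (fun i => m (τ i)),
      Function.Bijective Φ ∧
      ∀ a : KArrangement.withMult n m,
        (a : KArrangement n k).DEZ = (Φ a : KArrangement n k).DES ∧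
        (a : KArrangement n k).Der = (Φ a : KArrangement n k).Der := by
  have hfib (w : IntWord) :
      ∃ e : {a : KArrangement.withMult n m // a.1.Der = w} ≃
          {a : KArrangement.withMult n (fun i => m (τ i)) // a.1.Der = w},
        ∀ a, (e a).1.1.finDES = a.1.1.finDEZ := by
    have e (D : Finset ℕ) := (Finite.card_eq.1
      (KArrangement.card_DEZ_eq_card_DES (n := n) m τ w D)).some
    exact ⟨Equiv.ofFiberEquiv e, Equiv.ofFiberEquiv_map e⟩
  choose e he using hfib
  refine ⟨Equiv.ofFiberEquiv e, Equiv.bijective _, fun a => ⟨?_, ?_⟩⟩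
  · rw [← KArrangement.coe_finDEZ, ← KArrangement.coe_finDES]
    exact congrArg _ (he _ ⟨a, rfl⟩).symm
  · exact (Equiv.ofFiberEquiv_map e a).symm
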